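/- Let $\mathbb{K}$ be a field of characteristic $0$ and let $T$ be a finite-dimensional Leibniz triple system over $\mathbb{K}$, i.e. a finite-dimensional $\mathbb{K}$-vector space with a trilinear operation $\{\cdot,\cdot,\cdot\}\colon T\times T\times T\to T$ such that, for all $a,b,c,d,e\in T$, $$\{a\{bcd\}e\}=\{\{abc\}de\}-\{\{acb\}de\}-\{\{adb\}ce\}+\{\{adc\}be\},$$ $$\{ab\{cde\}\}=\{\{abc\}de\}-\{\{abd\}ce\}-\{\{abe\}cd\}+\{\{abe\}dc\}.$$ For subspaces $A,B,C\subseteq T$ let $\{ABC\}$ denote the linear span of all $\{abc\}$ with $a\in A$, $b\in B$, $c\in C$. A subspace $I\subseteq T$ is an ideal of $T$ if $\{ITT\}+\{TIT\}+\{TTI\}\subseteq I$. For an ideal $I$ put $I^{[0]}=I^0=I$ and, for $n\ge 0$, $$I^{[n+1]}=\{TI^{[n]}I^{[n]}\}+\{I^{[n]}TI^{[n]}\}+\{I^{[n]}I^{[n]}T\},$$ $$I^{n+1}=\{I^{n}IT\}+\{I^{n}TI\}+\{II^{n}T\}+\{ITI^{n}\}+\{TII^{n}\}+\{TI^{n}I\}.$$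 The ideal $I$ is called solvable if $I^{[k]}=0$ for some positive integer $k$, and nilpotent if $I^n=0$ for some $n\in\mathbb{N}$; $T$ is called solvable (resp. nilpotent) if it is so as an ideal of itself. Then: 1. If $T$ is nilpotent, then $T$ is solvable. 2. If $T$ is solvable, then $T^1=\{TTT\}$ is a nilpotent ideal of $T$. -/

import Mathlib

/-- A Leibniz triple system: a `K`-vector space `T` with a trilinear operation `{a b c}`
satisfying the two defining identities. -/
class LeibnizTripleSystem (K : Type*) (T : Type*) [Field K] [AddCommGroup T] [Module K T] where
  /-- The trilinear operation `{a b c}`. -/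
  triple : T →ₗ[K] T →ₗ[K] T →ₗ[K] T
  triple_mid : ∀ a b c d e : T,
    triple a (triple b c d) e =
      triple (triple a b c) d e - triple (triple a c b) d e
        - triple (triple a d b) c e + triple (triple a d c) b e
  triple_right : ∀ a b c d e : T,
    triple a b (triple c d e) =
      triple (triple a b c) d e - triple (triple a b d) c e
        - triple (triple a b e) c d + triple (triple a b e) d c

namespace LeibnizTripleSystem

/-- `{A B C}`: the subspace spanned by all `{a b c}` with `a ∈ A`, `b ∈ B`, `c ∈ C`. -/
def tripleSpan {K T : Type*} [Field K] [AddCommGroup T] [Module K T] [LeibnizTripleSystem K T]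
    (A B C : Submodule K T) : Submodule K T :=
  Submodule.span K {x : T | ∃ a ∈ A, ∃ b ∈ B, ∃ c ∈ C, x = triple (K := K) a b c}

/-- A subspace `I` is an ideal if `{I T T} + {T I T} + {T T I} ⊆ I`. -/
def IsIdeal {K T : Type*} [Field K] [AddCommGroup T] [Module K T] [LeibnizTripleSystem K T]
    (I : Submodule K T) : Prop :=
  tripleSpan I ⊤ ⊤ ⊔ tripleSpan ⊤ I ⊤ ⊔ tripleSpan ⊤ ⊤ I ≤ I

/-- The derived sequence `I^{[n]}`:
`I^{[0]} = I` and
`I^{[n+1]} = {T I^{[n]} I^{[n]}} + {I^{[n]} T I^{[n]}} + {I^{[n]} I^{[n]} T}`. -/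
def derivedSeq {K T : Type*} [Field K] [AddCommGroup T] [Module K T] [LeibnizTripleSystem K T]
    (I : Submodule K T) : ℕ → Submodule K T
  | 0 => I
  | n + 1 =>
      tripleSpan ⊤ (derivedSeq I n) (derivedSeq I n)
        ⊔ tripleSpan (derivedSeq I n) ⊤ (derivedSeq I n)
        ⊔ tripleSpan (derivedSeq I n) (derivedSeq I n) ⊤

/-- The central lower sequence `I^n`:
`I^0 = I` and
`I^{n+1} = {I^n I T} + {I^n T I} + {I I^n T} + {I T I^n} + {T I I^n} + {T I^n I}`. -/
def lowerSeq {K T : Type*} [Field K] [AddCommGroup T] [Module K T] [LeibnizTripleSystem K T]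
    (I : Submodule K T) : ℕ → Submodule K T
  | 0 => I
  | n + 1 =>
      tripleSpan (lowerSeq I n) I ⊤ ⊔ tripleSpan (lowerSeq I n) ⊤ I
        ⊔ tripleSpan I (lowerSeq I n) ⊤ ⊔ tripleSpan I ⊤ (lowerSeq I n)
        ⊔ tripleSpan ⊤ I (lowerSeq I n) ⊔ tripleSpan ⊤ (lowerSeq I n) I

/-- `I` is a solvable ideal of `T`. -/
def IsSolvableIdeal {K T : Type*} [Field K] [AddCommGroup T] [Module K T]
    [LeibnizTripleSystem K T] (I : Submodule K T) : Prop :=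
  IsIdeal I ∧ ∃ k : ℕ, 0 < k ∧ derivedSeq I k = ⊥

/-- `I` is a nilpotent ideal of `T`. -/
def IsNilpotentIdeal {K T : Type*} [Field K] [AddCommGroup T] [Module K T]
    [LeibnizTripleSystem K T] (I : Submodule K T) : Prop :=
  IsIdeal I ∧ ∃ n : ℕ, lowerSeq I n = ⊥

/-- `T` is solvable, i.e. it is a solvable ideal of itself. -/
def IsSolvableSystem (K T : Type*) [Field K] [AddCommGroup T] [Module K T]
    [LeibnizTripleSystem K T] : Prop :=
  IsSolvableIdeal (⊤ : Submodule K T)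

/-- `T` is nilpotent, i.e. it is a nilpotent ideal of itself. -/
def IsNilpotentSystem (K T : Type*) [Field K] [AddCommGroup T] [Module K T]
    [LeibnizTripleSystem K T] : Prop :=
  IsNilpotentIdeal (⊤ : Submodule K T)

end LeibnizTripleSystem

/-! Nilpotent implies solvable because the derived sequence of `T` lies termwise in the lower
sequence. For the converse direction, pass to Lie algebras. A Leibniz triple product behaves like
`[[a,b],c]` in a Leibniz algebra, and right multiplications `R` on the envelope `M` of `T` satisfy
`R {a b c} = ⁅⁅R a, R b⁆, R c⁆` (`rightMul_triple`). So all `R a` and `⁅R a, R b⁆` span a Lie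
algebra `g` of endomorphisms of `M`. Two derived steps of `g` cover one derived step of `T`, so `g`
is solvable with `T` (`isSolvable_lieEnvelopeSubalgebra`). By Lie's theorem `D = ⁅g, g⁆` acts
nilpotently on the finite-dimensional `M`, and `D` contains `R x` for every `x` in `{T T T}`. The
finite filtration of `M` by powers of `D` then forces the lower sequence of `{T T T}` to vanish
(`IsIdeal.isNilpotentIdeal_of_filtration`). -/

section
-- Consequences of Lie's theorem
open scoped TensorProduct

/-- Over an algebraically closed field of characteristic zero, the derived ideal of a solvable Lie
algebra acts by nilpotent endomorphisms on every finite-dimensional module. -/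
theorem LieModule.isNilpotent_toEnd_of_mem_derivedSeries_of_isAlgClosed
    {K L : Type*} [Field K] [CharZero K] [IsAlgClosed K] [LieRing L] [LieAlgebra K L]
    [LieAlgebra.IsSolvable L] {x : L} (hx : x ∈ LieAlgebra.derivedSeries K L 1)
    (V : Type*) [AddCommGroup V] [Module K V] [LieRingModule L V] [LieModule K L V]
    [FiniteDimensional K V] : _root_.IsNilpotent (LieModule.toEnd K L V x) := by
  induction hn : Module.finrank K V using Nat.strong_induction_on generalizing V with
  | _ n ih =>
    rcases subsingleton_or_nontrivial V with _ | _
    · exact ⟨1, LinearMap.ext fun v ↦ Subsingleton.elim _ _⟩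
    obtain ⟨χ, hχ⟩ := LieModule.exists_nontrivial_weightSpace_of_isSolvable K L V
    obtain ⟨⟨v, hv⟩, hv0⟩ := exists_ne (0 : LieModule.weightSpace V χ)
    replace hv0 : v ≠ 0 := fun h ↦ hv0 (Subtype.ext h)
    rw [LieModule.mem_weightSpace] at hv
    -- Brackets act by commutators of scalars on a common eigenvector.
    have hxv : ⁅x, v⁆ = 0 := by
      have hx' : x ∈ Submodule.span K {⁅a, b⁆ | (a : L) (b : L)} :=
        LieAlgebra.coe_derivedSeries_one_eq K L ▸ hx
      clear hx ih
      induction hx' using Submodule.span_induction with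
      | mem y hy =>
        obtain ⟨a, b, rfl⟩ := hy
        rw [lie_lie, hv, hv, lie_smul, lie_smul, hv, hv, smul_comm, sub_self]
      | zero => exact zero_lie v
      | add y z _ _ hy hz => rw [add_lie, hy, hz, add_zero]
      | smul c y _ hy => rw [smul_lie, hy, smul_zero]
    let W : LieSubmodule K L V :=
      { K ∙ v with
        lie_mem := by
          intro y w hw
          obtain ⟨c, rfl⟩ := Submodule.mem_span_singleton.mp hw
          rw [lie_smul, hv]
          exact Submodule.smul_mem _ _ (Submodule.smul_mem _ _ (Submodule.mem_span_singleton_self v)) }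
    have hlt : Module.finrank K (V ⧸ W) < n := by
      rw [← hn]
      have hpos : 0 < Module.finrank K (K ∙ v) := by rw [finrank_span_singleton hv0]; exact one_pos
      have hadd := Submodule.finrank_quotient_add_finrank (K ∙ v)
      change Module.finrank K (V ⧸ K ∙ v) < _
      lia
    obtain ⟨m, hm⟩ := ih _ hlt (V ⧸ W) rfl
    have hcomm : ∀ (i : ℕ) (w : V), ((LieModule.toEnd K L (V ⧸ W) x) ^ i)
        (LieSubmodule.Quotient.mk w) =
          LieSubmodule.Quotient.mk (((LieModule.toEnd K L V x) ^ i) w) := by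
      intro i w
      induction i with
      | zero => rfl
      | succ i ih => rw [pow_succ', pow_succ', Module.End.mul_apply, Module.End.mul_apply, ih]; rfl
    -- By induction `x ^ m` kills `V ⧸ W`, so it maps `V` into the line of `v`; one more `x` kills
    -- that line.
    refine ⟨m + 1, LinearMap.ext fun w ↦ ?_⟩
    have hw := hcomm m w
    rw [hm] at hw
    have hmem : ((LieModule.toEnd K L V x) ^ m) w ∈ W :=
      (LieSubmodule.Quotient.mk_eq_zero (N := W)).mp hw.symm
    obtain ⟨c, hc⟩ := Submodule.mem_span_singleton.mp (show _ ∈ K ∙ v from hmem)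
    rw [pow_succ', Module.End.mul_apply, ← hc, LieModule.toEnd_apply_apply, lie_smul, hxv,
      smul_zero]
    rfl

/-- In characteristic zero, every finite-dimensional module over a solvable Lie algebra is a
nilpotent module over the derived ideal. -/
theorem LieModule.isNilpotent_derivedSeries_of_isSolvable
    (K L V : Type*) [Field K] [CharZero K] [LieRing L] [LieAlgebra K L] [LieAlgebra.IsSolvable L]
    [AddCommGroup V] [Module K V] [LieRingModule L V] [LieModule K L V] [FiniteDimensional K V] :
    LieModule.IsNilpotent (LieAlgebra.derivedSeries K L 1) V := by
  rw [LieModule.isNilpotent_iff_forall' (R := K)]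
  rintro ⟨x, hx⟩
  -- Engel's theorem leaves single elements to treat, and nilpotency of an endomorphism descends
  -- from the algebraic closure.
  let A := AlgebraicClosure K
  have hx_ext : (1 : A) ⊗ₜ[K] x ∈ LieAlgebra.derivedSeries A (A ⊗[K] L) 1 := by
    rw [LieAlgebra.derivedSeries_baseChange]
    exact Submodule.tmul_mem_baseChange_of_mem 1 hx
  have hinj : Function.Injective (Module.End.baseChangeHom K A V) :=
    LinearMap.baseChangeHom_injective K V A
  have haux : Module.End.baseChangeHom K A V
      (LieModule.toEnd K (LieAlgebra.derivedSeries K L 1) V ⟨x, hx⟩) =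
      (LieModule.toEnd K L V x).baseChange A := rfl
  rw [← IsNilpotent.map_iff hinj, haux, ← LieModule.toEnd_baseChange]
  exact LieModule.isNilpotent_toEnd_of_mem_derivedSeries_of_isAlgClosed hx_ext (A ⊗[K] V)

end

namespace LeibnizTripleSystem

/-! ### Spans of `R a` and `⁅R a, R b⁆` in a Lie algebra -/

section LieEnvelope

variable {K T L : Type*} [Field K] [AddCommGroup T] [Module K T] [LieRing L]
  [LieAlgebra K L] {R : T →ₗ[K] L} {I : Submodule K T}

/-- The span of `R a` and `⁅R a, R b⁆` for `a ∈ I` and `b ∈ T`. -/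
def lieEnvelope (R : T →ₗ[K] L) (I : Submodule K T) : Submodule K L :=
  Submodule.span K ({x | ∃ a ∈ I, x = R a} ∪ {x | ∃ a ∈ I, ∃ b, x = ⁅R a, R b⁆})

theorem map_mem_lieEnvelope {a : T} (ha : a ∈ I) : R a ∈ lieEnvelope R I :=
  Submodule.subset_span (.inl ⟨a, ha, rfl⟩)

theorem lie_mem_lieEnvelope_left {a : T} (ha : a ∈ I) (b : T) : ⁅R a, R b⁆ ∈ lieEnvelope R I :=
  Submodule.subset_span (.inr ⟨a, ha, b, rfl⟩)

theorem lieEnvelope_le {P : Submodule K L} : lieEnvelope R I ≤ P ↔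
    (∀ a ∈ I, R a ∈ P) ∧ ∀ a ∈ I, ∀ b, ⁅R a, R b⁆ ∈ P := by
  rw [lieEnvelope, Submodule.span_le]
  constructor
  · exact fun h ↦ ⟨fun a ha ↦ h (.inl ⟨a, ha, rfl⟩), fun a ha b ↦ h (.inr ⟨a, ha, b, rfl⟩)⟩
  · rintro ⟨h₁, h₂⟩ _ (⟨a, ha, rfl⟩ | ⟨a, ha, b, rfl⟩)
    exacts [h₁ a ha, h₂ a ha b]

@[simp]
theorem lieEnvelope_bot : lieEnvelope R (⊥ : Submodule K T) = ⊥ := by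
  rw [← le_bot_iff, lieEnvelope_le]
  simp

theorem lie_mem_of_forall_lieEnvelope {P : Submodule K L} {x y : L}
    (h₁ : ∀ a ∈ I, ⁅x, R a⁆ ∈ P) (h₂ : ∀ a ∈ I, ∀ b, ⁅x, ⁅R a, R b⁆⁆ ∈ P)
    (hy : y ∈ lieEnvelope R I) : ⁅x, y⁆ ∈ P :=
  show y ∈ P.comap (LieModule.toEnd K L L x) from lieEnvelope_le.mpr ⟨h₁, h₂⟩ hy

end LieEnvelope

section

variable {K T L : Type*} [Field K] [AddCommGroup T] [Module K T] [LeibnizTripleSystem K T]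

theorem triple_mem_tripleSpan {A B C : Submodule K T} {a b c : T} (ha : a ∈ A) (hb : b ∈ B)
    (hc : c ∈ C) : triple (K := K) a b c ∈ tripleSpan A B C :=
  Submodule.subset_span ⟨a, ha, b, hb, c, hc, rfl⟩

theorem tripleSpan_le {A B C D : Submodule K T} :
    tripleSpan A B C ≤ D ↔ ∀ a ∈ A, ∀ b ∈ B, ∀ c ∈ C, triple (K := K) a b c ∈ D := by
  rw [tripleSpan, Submodule.span_le]
  constructor
  · exact fun h a ha b hb c hc ↦ h ⟨a, ha, b, hb, c, hc, rfl⟩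
  · rintro h _ ⟨a, ha, b, hb, c, hc, rfl⟩
    exact h a ha b hb c hc

theorem tripleSpan_mono {A B C A' B' C' : Submodule K T} (hA : A ≤ A') (hB : B ≤ B')
    (hC : C ≤ C') : tripleSpan A B C ≤ tripleSpan A' B' C' :=
  tripleSpan_le.mpr fun _ ha _ hb _ hc ↦ triple_mem_tripleSpan (hA ha) (hB hb) (hC hc)

theorem isIdeal_iff {I : Submodule K T} : IsIdeal I ↔
    (∀ a ∈ I, ∀ b c, triple (K := K) a b c ∈ I) ∧ (∀ b ∈ I, ∀ a c, triple (K := K) a b c ∈ I) ∧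
      ∀ c ∈ I, ∀ a b, triple (K := K) a b c ∈ I := by
  simp only [IsIdeal, sup_le_iff, tripleSpan_le, Submodule.mem_top, true_implies, and_assoc]
  refine and_congr ⟨fun h ↦ h, fun h ↦ h⟩ (and_congr ?_ ?_)
  · exact ⟨fun h b hb a c ↦ h a b hb c, fun h a b hb c ↦ h b hb a c⟩
  · exact ⟨fun h c hc a b ↦ h a b c hc, fun h a b c hc ↦ h c hc a b⟩

theorem isIdeal_top : IsIdeal (⊤ : Submodule K T) := le_top

theorem isIdeal_tripleSpan_top : IsIdeal (tripleSpan (⊤ : Submodule K T) ⊤ ⊤) :=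
  sup_le (sup_le (tripleSpan_mono le_top le_top le_top) (tripleSpan_mono le_top le_top le_top))
    (tripleSpan_mono le_top le_top le_top)

/-- The next term `{T I I} + {I T I} + {I I T}` of the derived sequence. -/
def derivedIdeal (I : Submodule K T) : Submodule K T :=
  tripleSpan ⊤ I I ⊔ tripleSpan I ⊤ I ⊔ tripleSpan I I ⊤

theorem derivedSeq_succ (I : Submodule K T) (n : ℕ) :
    derivedSeq I (n + 1) = derivedIdeal (derivedSeq I n) := rfl

/-! ### Derived ideals and their stability -/

section derivedIdeal

variable {I J : Submodule K T}

theorem triple_mem_derivedIdeal_of_mid_right (a : T) {b c : T} (hb : b ∈ I) (hc : c ∈ I) :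
    triple (K := K) a b c ∈ derivedIdeal I :=
  Submodule.mem_sup_left (Submodule.mem_sup_left
    (triple_mem_tripleSpan Submodule.mem_top hb hc))

theorem triple_mem_derivedIdeal_of_left_right {a : T} (b : T) {c : T} (ha : a ∈ I) (hc : c ∈ I) :
    triple (K := K) a b c ∈ derivedIdeal I :=
  Submodule.mem_sup_left (Submodule.mem_sup_right
    (triple_mem_tripleSpan ha Submodule.mem_top hc))

theorem triple_mem_derivedIdeal_of_left_mid {a b : T} (c : T) (ha : a ∈ I) (hb : b ∈ I) :
    triple (K := K) a b c ∈ derivedIdeal I :=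
  Submodule.mem_sup_right (triple_mem_tripleSpan ha hb Submodule.mem_top)

theorem derivedIdeal_le : derivedIdeal I ≤ J ↔
    (∀ a, ∀ b ∈ I, ∀ c ∈ I, triple (K := K) a b c ∈ J) ∧
      (∀ a ∈ I, ∀ b, ∀ c ∈ I, triple (K := K) a b c ∈ J) ∧
        ∀ a ∈ I, ∀ b ∈ I, ∀ c, triple (K := K) a b c ∈ J := by
  simp only [derivedIdeal, sup_le_iff, tripleSpan_le, Submodule.mem_top, true_implies, and_assoc]

theorem triple_triple_right (a b c d e : T) :
    triple (K := K) (triple (K := K) a b c) d e =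
      triple (K := K) a b (triple (K := K) c d e) + triple (K := K) (triple (K := K) a b d) c e
        + triple (K := K) (triple (K := K) a b e) c d
        - triple (K := K) (triple (K := K) a b e) d c := by
  rw [triple_right]; abel

theorem triple_triple_mid (a b c d e : T) :
    triple (K := K) (triple (K := K) a b c) d e =
      triple (K := K) a (triple (K := K) b c d) e + triple (K := K) (triple (K := K) a c b) d e
        + triple (K := K) (triple (K := K) a d b) c e
        - triple (K := K) (triple (K := K) a d c) b e := by
  rw [triple_mid]; abel

/-- The delicate case is a product nested in the left slot. The defining identities, solved for that
term, rewrite it by products having two entries in `I`, or by nested products already treated; hence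
the order `left_mr`, `left_lr`, `left_lm`. -/
theorem IsIdeal.derivedIdeal (hI : IsIdeal I) : IsIdeal (derivedIdeal I) := by
  obtain ⟨h₁, h₂, h₃⟩ := isIdeal_iff.mp hI
  have left_mr (a : T) {b c : T} (d e : T) (hb : b ∈ I) (hc : c ∈ I) :
      triple (K := K) (triple (K := K) a b c) d e ∈ LeibnizTripleSystem.derivedIdeal I := by
    rw [triple_triple_right]
    exact sub_mem (add_mem (add_mem (triple_mem_derivedIdeal_of_mid_right _ hb (h₁ _ hc _ _))
      (triple_mem_derivedIdeal_of_left_mid _ (h₂ _ hb _ _) hc))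
      (triple_mem_derivedIdeal_of_left_mid _ (h₂ _ hb _ _) hc))
      (triple_mem_derivedIdeal_of_left_right _ (h₂ _ hb _ _) hc)
  have left_lr {a : T} (b : T) {c : T} (d e : T) (ha : a ∈ I) (hc : c ∈ I) :
      triple (K := K) (triple (K := K) a b c) d e ∈ LeibnizTripleSystem.derivedIdeal I := by
    rw [triple_triple_right]
    exact sub_mem (add_mem (add_mem (triple_mem_derivedIdeal_of_left_right _ ha (h₁ _ hc _ _))
      (triple_mem_derivedIdeal_of_left_mid _ (h₁ _ ha _ _) hc))
      (triple_mem_derivedIdeal_of_left_mid _ (h₁ _ ha _ _) hc))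
      (triple_mem_derivedIdeal_of_left_right _ (h₁ _ ha _ _) hc)
  have left_lm {a b : T} (c d e : T) (ha : a ∈ I) (hb : b ∈ I) :
      triple (K := K) (triple (K := K) a b c) d e ∈ LeibnizTripleSystem.derivedIdeal I := by
    rw [triple_triple_mid]
    exact sub_mem (add_mem (add_mem (triple_mem_derivedIdeal_of_left_mid _ ha (h₁ _ hb _ _))
      (left_lr _ _ _ ha hb)) (left_lr _ _ _ ha hb))
      (triple_mem_derivedIdeal_of_left_mid _ (h₁ _ ha _ _) hb)
  rw [isIdeal_iff]
  refine ⟨fun x hx d e ↦ ?_, fun x hx a e ↦ ?_, fun x hx a b ↦ ?_⟩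
  · suffices LeibnizTripleSystem.derivedIdeal I ≤ (LeibnizTripleSystem.derivedIdeal I).comap
      ((triple (K := K)).flip d |>.flip e) from this hx
    exact derivedIdeal_le.mpr ⟨fun a b hb c hc ↦ left_mr a d e hb hc,
      fun a ha b c hc ↦ left_lr b d e ha hc, fun a ha b hb c ↦ left_lm c d e ha hb⟩
  · suffices LeibnizTripleSystem.derivedIdeal I ≤ (LeibnizTripleSystem.derivedIdeal I).comap
      ((triple (K := K) a).flip e) from this hx
    refine derivedIdeal_le.mpr ⟨fun b c hc d hd ↦ ?_, fun b hb c d hd ↦ ?_, fun b hb c hc d ↦ ?_⟩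
    all_goals rw [Submodule.mem_comap, LinearMap.flip_apply, triple_mid]
    · exact add_mem (sub_mem (sub_mem (triple_mem_derivedIdeal_of_left_mid _ (h₃ _ hc _ _) hd)
        (triple_mem_derivedIdeal_of_left_mid _ (h₂ _ hc _ _) hd))
        (triple_mem_derivedIdeal_of_left_mid _ (h₂ _ hd _ _) hc)) (left_mr _ _ _ hd hc)
    · exact add_mem (sub_mem (sub_mem (triple_mem_derivedIdeal_of_left_mid _ (h₂ _ hb _ _) hd)
        (triple_mem_derivedIdeal_of_left_mid _ (h₃ _ hb _ _) hd)) (left_mr _ _ _ hd hb))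
        (triple_mem_derivedIdeal_of_left_mid _ (h₂ _ hd _ _) hb)
    · exact add_mem (sub_mem (sub_mem (left_mr _ _ _ hb hc) (left_mr _ _ _ hc hb))
        (triple_mem_derivedIdeal_of_left_mid _ (h₃ _ hb _ _) hc))
        (triple_mem_derivedIdeal_of_left_mid _ (h₃ _ hc _ _) hb)
  · suffices LeibnizTripleSystem.derivedIdeal I ≤ (LeibnizTripleSystem.derivedIdeal I).comap
      (triple (K := K) a b) from this hx
    refine derivedIdeal_le.mpr ⟨fun c d hd e he ↦ ?_, fun c hc d e he ↦ ?_, fun c hc d hd e ↦ ?_⟩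
    all_goals rw [Submodule.mem_comap, triple_right]
    · exact add_mem (sub_mem (sub_mem (triple_mem_derivedIdeal_of_mid_right _ hd he)
        (triple_mem_derivedIdeal_of_left_right _ (h₃ _ hd _ _) he))
        (triple_mem_derivedIdeal_of_left_right _ (h₃ _ he _ _) hd))
        (triple_mem_derivedIdeal_of_left_mid _ (h₃ _ he _ _) hd)
    · exact add_mem (sub_mem (sub_mem (triple_mem_derivedIdeal_of_left_right _ (h₃ _ hc _ _) he)
        (triple_mem_derivedIdeal_of_mid_right _ hc he))
        (triple_mem_derivedIdeal_of_left_mid _ (h₃ _ he _ _) hc))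
        (triple_mem_derivedIdeal_of_left_right _ (h₃ _ he _ _) hc)
    · exact add_mem (sub_mem (sub_mem (triple_mem_derivedIdeal_of_left_mid _ (h₃ _ hc _ _) hd)
        (triple_mem_derivedIdeal_of_left_mid _ (h₃ _ hd _ _) hc))
        (triple_mem_derivedIdeal_of_mid_right _ hc hd))
        (triple_mem_derivedIdeal_of_mid_right _ hd hc)

end derivedIdeal
theorem IsIdeal.derivedSeq {I : Submodule K T} (hI : IsIdeal I) (n : ℕ) :
    IsIdeal (derivedSeq I n) := by
  induction n with
  | zero => exact hI
  | succ n ih => exact ih.derivedIdeal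

theorem derivedSeq_top_le_lowerSeq_top (n : ℕ) :
    LeibnizTripleSystem.derivedSeq (⊤ : Submodule K T) n ≤ lowerSeq ⊤ n := by
  induction n with
  | zero => exact le_rfl
  | succ n ih =>
    rw [derivedSeq_succ, derivedIdeal_le]
    refine ⟨fun a b _ c hc ↦ ?_, fun a _ b c hc ↦ ?_, fun a ha b _ c ↦ ?_⟩
    · exact Submodule.mem_sup_left (Submodule.mem_sup_right
        (triple_mem_tripleSpan Submodule.mem_top Submodule.mem_top (ih hc)))
    · exact Submodule.mem_sup_left (Submodule.mem_sup_right
        (triple_mem_tripleSpan Submodule.mem_top Submodule.mem_top (ih hc)))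
    · simp only [lowerSeq, sup_assoc]
      exact Submodule.mem_sup_left
        (triple_mem_tripleSpan (ih ha) Submodule.mem_top Submodule.mem_top)

theorem IsNilpotentSystem.isSolvableSystem (h : IsNilpotentSystem K T) : IsSolvableSystem K T := by
  obtain ⟨hI, n, hn⟩ := h
  -- Solvability asks for a positive index, while `n` may be `0`.
  refine ⟨hI, n + 1, n.succ_pos, ?_⟩
  have hbot : LeibnizTripleSystem.derivedSeq (⊤ : Submodule K T) n = ⊥ :=
    le_bot_iff.mp (hn ▸ derivedSeq_top_le_lowerSeq_top n)
  rw [derivedSeq_succ, hbot, ← le_bot_iff, derivedIdeal_le]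
  simp +contextual

theorem lowerSeq_top_one : lowerSeq (⊤ : Submodule K T) 1 = tripleSpan ⊤ ⊤ ⊤ := by
  simp only [lowerSeq, sup_idem]

/-! ### Solvability of the Lie envelope -/

section Solvable

variable [LieRing L] [LieAlgebra K L] {R : T →ₗ[K] L} {I : Submodule K T}

theorem lie_lie_lie_map (hR : ∀ a b c, R (triple (K := K) a b c) = ⁅⁅R a, R b⁆, R c⁆)
    (a b c d : T) : ⁅⁅R a, R b⁆, ⁅R c, R d⁆⁆ =
      ⁅R (triple (K := K) a b c), R d⁆ - ⁅R (triple (K := K) a b d), R c⁆ := by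
  rw [leibniz_lie, hR, hR, ← lie_skew (R c), sub_eq_add_neg]

/-- Triple brackets of values of `R` fold back into values of `R`, and quadruple ones into double
ones. For `I = ⊤` this gives a subalgebra, for an ideal a Lie ideal in it. -/
theorem lie_mem_lieEnvelope (hR : ∀ a b c, R (triple (K := K) a b c) = ⁅⁅R a, R b⁆, R c⁆)
    (hI : IsIdeal I) {x y : L} (hx : x ∈ lieEnvelope R I) (hy : y ∈ lieEnvelope R ⊤) :
    ⁅x, y⁆ ∈ lieEnvelope R I := by
  obtain ⟨h₁, h₂, h₃⟩ := isIdeal_iff.mp hI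
  rw [← lie_skew]
  refine neg_mem (lie_mem_of_forall_lieEnvelope (fun a ha ↦ ?_) (fun a ha b ↦ ?_) hx) <;>
    rw [← lie_skew] <;>
    refine neg_mem (lie_mem_of_forall_lieEnvelope (fun c _ ↦ ?_) (fun c _ d ↦ ?_) hy)
  · exact lie_mem_lieEnvelope_left ha c
  · rw [← lie_skew, ← hR]
    exact neg_mem (map_mem_lieEnvelope (h₃ _ ha _ _))
  · rw [← hR]
    exact map_mem_lieEnvelope (h₁ _ ha _ _)
  · rw [lie_lie_lie_map hR]
    exact sub_mem (lie_mem_lieEnvelope_left (h₁ _ ha _ _) _)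
      (lie_mem_lieEnvelope_left (h₁ _ ha _ _) _)

/-- The bracket of `lieEnvelope R I` with itself lies in `lieEnvelope R I'` up to the brackets
`⁅R a, R b⁆` with `a, b ∈ I`. -/
theorem lie_mem_lieEnvelope_derivedIdeal_sup
    (hR : ∀ a b c, R (triple (K := K) a b c) = ⁅⁅R a, R b⁆, R c⁆)
    (hI : IsIdeal I) {x y : L} (hx : x ∈ lieEnvelope R I) (hy : y ∈ lieEnvelope R I) :
    ⁅x, y⁆ ∈ lieEnvelope R (derivedIdeal I) ⊔
      Submodule.span K {x | ∃ a ∈ I, ∃ b ∈ I, x = ⁅R a, R b⁆} := by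
  obtain ⟨h₁, h₂, h₃⟩ := isIdeal_iff.mp hI
  rw [← lie_skew]
  refine neg_mem (lie_mem_of_forall_lieEnvelope (fun a ha ↦ ?_) (fun a ha b ↦ ?_) hx) <;>
    rw [← lie_skew] <;>
    refine neg_mem (lie_mem_of_forall_lieEnvelope (fun c hc ↦ ?_) (fun c hc d ↦ ?_) hy)
  · exact Submodule.mem_sup_right (Submodule.subset_span ⟨a, ha, c, hc, rfl⟩)
  · rw [← lie_skew, ← hR]
    exact neg_mem (Submodule.mem_sup_left
      (map_mem_lieEnvelope (triple_mem_derivedIdeal_of_left_right _ hc ha)))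
  · rw [← hR]
    exact Submodule.mem_sup_left
      (map_mem_lieEnvelope (triple_mem_derivedIdeal_of_left_right _ ha hc))
  -- The second term has both entries in `I` but need not come from `derivedIdeal I`: it goes to the
  -- extra summand.
  · rw [lie_lie_lie_map hR]
    exact sub_mem (Submodule.mem_sup_left
      (lie_mem_lieEnvelope_left (triple_mem_derivedIdeal_of_left_right _ ha hc) _))
      (Submodule.mem_sup_right (Submodule.subset_span ⟨_, h₁ _ ha _ _, c, hc, rfl⟩))

/-- A second bracket absorbs the leftover: bracketing `⁅R a, R b⁆` with `R c` gives `R {a b c}`,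
which has two entries in `I`. -/
theorem lie_mem_lieEnvelope_derivedIdeal
    (hR : ∀ a b c, R (triple (K := K) a b c) = ⁅⁅R a, R b⁆, R c⁆)
    (hI : IsIdeal I) {x y : L} (hx : x ∈ lieEnvelope R (derivedIdeal I) ⊔
      Submodule.span K {x | ∃ a ∈ I, ∃ b ∈ I, x = ⁅R a, R b⁆}) (hy : y ∈ lieEnvelope R ⊤) :
    ⁅x, y⁆ ∈ lieEnvelope R (derivedIdeal I) := by
  rw [← lie_skew]
  refine neg_mem ?_
  suffices _ ≤ (lieEnvelope R (derivedIdeal I)).comap (LieModule.toEnd K L L y) from this hx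
  refine sup_le (fun z hz ↦ ?_) (Submodule.span_le.mpr ?_)
  · rw [Submodule.mem_comap, LieModule.toEnd_apply_apply, ← lie_skew]
    exact neg_mem (lie_mem_lieEnvelope hR hI.derivedIdeal hz hy)
  · rintro _ ⟨a, ha, b, hb, rfl⟩
    rw [SetLike.mem_coe, Submodule.mem_comap, LieModule.toEnd_apply_apply, ← lie_skew]
    refine neg_mem (lie_mem_of_forall_lieEnvelope (fun c _ ↦ ?_) (fun c _ d ↦ ?_) hy)
    · rw [← hR]
      exact map_mem_lieEnvelope (triple_mem_derivedIdeal_of_left_mid _ ha hb)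
    · rw [lie_lie_lie_map hR]
      exact sub_mem
        (lie_mem_lieEnvelope_left (triple_mem_derivedIdeal_of_left_mid _ ha hb) _)
        (lie_mem_lieEnvelope_left (triple_mem_derivedIdeal_of_left_mid _ ha hb) _)

/-- The Lie subalgebra spanned by all `R a` and `⁅R a, R b⁆`. -/
def lieEnvelopeSubalgebra (R : T →ₗ[K] L)
    (hR : ∀ a b c, R (triple (K := K) a b c) = ⁅⁅R a, R b⁆, R c⁆) : LieSubalgebra K L :=
  { lieEnvelope R ⊤ with lie_mem' := fun hx hy ↦ lie_mem_lieEnvelope hR isIdeal_top hx hy }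

theorem isSolvable_lieEnvelopeSubalgebra (h : IsSolvableSystem K T)
    (hR : ∀ a b c, R (triple (K := K) a b c) = ⁅⁅R a, R b⁆, R c⁆) :
    LieAlgebra.IsSolvable (lieEnvelopeSubalgebra R hR) := by
  let g := lieEnvelopeSubalgebra R hR
  have key (n : ℕ) : ∀ x ∈ LieAlgebra.derivedSeries K g (2 * n),
      (x : L) ∈ lieEnvelope R (LeibnizTripleSystem.derivedSeq ⊤ n) := by
    induction n with
    | zero => exact fun x _ ↦ x.2
    | succ n ih =>
      have hI := isIdeal_top.derivedSeq (K := K) (T := T) n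
      have step (I : LieIdeal K g) (P Q : Submodule K L) (hP : ∀ x ∈ I, (x : L) ∈ P)
          (hPQ : ∀ x ∈ P, ∀ y ∈ P, y ∈ lieEnvelope R ⊤ → ⁅x, y⁆ ∈ Q) :
          ∀ x ∈ ⁅I, I⁆, (x : L) ∈ Q := by
        intro x hx
        rw [← LieSubmodule.mem_toSubmodule, LieSubmodule.lieIdeal_oper_eq_linear_span'] at hx
        suffices _ ≤ Q.comap g.toSubmodule.subtype from this hx
        rw [Submodule.span_le]
        rintro _ ⟨y, hy, z, hz, rfl⟩
        exact hPQ _ (hP y hy) _ (hP z hz) z.2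
      rw [mul_add, mul_one, LieAlgebra.derivedSeries_def, LieAlgebra.derivedSeriesOfIdeal_succ,
        LieAlgebra.derivedSeriesOfIdeal_succ, derivedSeq_succ]
      exact step _ _ _ (step _ _ _ ih
        fun x hx y hy _ ↦ lie_mem_lieEnvelope_derivedIdeal_sup hR hI hx hy)
        fun x hx y _ hy ↦ lie_mem_lieEnvelope_derivedIdeal hR hI hx hy
  obtain ⟨-, k, -, hk⟩ := h
  refine LieAlgebra.IsSolvable.mk (R := K) (k := 2 * k) ((LieSubmodule.eq_bot_iff _).mpr
    fun x hx ↦ ?_)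
  have hx0 := key k x hx
  rw [hk, lieEnvelope_bot, Submodule.mem_bot] at hx0
  exact Subtype.ext hx0

end Solvable

end

end LeibnizTripleSystem

namespace LeibnizTripleSystem

/-! ### Right multiplications on the Leibniz envelope -/

section Representation

variable (K T : Type*) [Field K] [AddCommGroup T] [Module K T] [LeibnizTripleSystem K T]

/-- The span of the left multiplications `c ↦ {a b c}`. -/
def leftMulSpan : Submodule K (T →ₗ[K] T) :=
  Submodule.span K {f | ∃ a b : T, f = triple (K := K) a b}

variable {K T}

theorem triple_mem_leftMulSpan (a b : T) : triple (K := K) a b ∈ leftMulSpan K T :=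
  Submodule.subset_span ⟨a, b, rfl⟩

variable (K T) in
/-- The action of `T` by right multiplications on its standard Leibniz envelope, the sum of `T` and
the span of the left multiplications: `x ↦ (c ↦ {x b c})` on `T`, and `f ↦ f b` on the span. -/
def rightMul : T →ₗ[K] Module.End K (T × leftMulSpan K T) :=
  LinearMap.mk₂ K
    (fun b v ↦ ((v.2 : T →ₗ[K] T) b, ⟨triple (K := K) v.1 b, triple_mem_leftMulSpan _ _⟩))
    (fun _ _ _ ↦ Prod.ext (map_add _ _ _) (Subtype.ext (map_add _ _ _)))
    (fun _ _ _ ↦ Prod.ext (map_smul _ _ _) (Subtype.ext (map_smul _ _ _)))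
    (fun _ _ _ ↦ Prod.ext rfl (Subtype.ext (by simp)))
    (fun _ _ _ ↦ Prod.ext rfl (Subtype.ext (by simp)))

theorem rightMul_apply (b : T) (v : T × leftMulSpan K T) : rightMul K T b v =
    ((v.2 : T →ₗ[K] T) b, ⟨triple (K := K) v.1 b, triple_mem_leftMulSpan _ _⟩) := rfl

/-- Each defining identity accounts for one summand: `triple_right` for the left multiplications,
`triple_mid` for `T`. -/
theorem rightMul_triple (a b c : T) : rightMul K T (triple (K := K) a b c) =
    ⁅⁅rightMul K T a, rightMul K T b⁆, rightMul K T c⁆ := by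
  refine LinearMap.ext fun v ↦ ?_
  obtain ⟨x, f, hf⟩ := v
  simp only [Ring.lie_def, LinearMap.sub_apply, Module.End.mul_apply, rightMul_apply, map_sub]
  refine Prod.ext ?_ (Subtype.ext (LinearMap.ext fun e ↦ ?_))
  · induction hf using Submodule.span_induction with
    | mem f hf =>
      obtain ⟨d, e, rfl⟩ := hf
      simp only [Prod.fst_sub, triple_right]
      abel
    | zero => simp
    | add f g _ _ hf hg =>
      simp at hf hg ⊢
      rw [hf, hg]; abel
    | smul k f _ hf =>
      simp at hf ⊢
      rw [hf]; simp only [smul_sub]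
  · simp only [Submodule.coe_sub, LinearMap.sub_apply, Prod.snd_sub, triple_mid]
    abel

end Representation

/-! ### Nilpotency from a filtration -/

section Nilpotent

variable {K T : Type*} [Field K] [AddCommGroup T] [Module K T] [LeibnizTripleSystem K T]

theorem lowerSeq_succ_le {I J : Submodule K T} {n : ℕ}
    (h₁ : ∀ a ∈ lowerSeq I n, ∀ b ∈ I, ∀ c, triple (K := K) a b c ∈ J)
    (h₂ : ∀ a ∈ lowerSeq I n, ∀ b, ∀ c ∈ I, triple (K := K) a b c ∈ J)
    (h₃ : ∀ a ∈ I, ∀ b ∈ lowerSeq I n, ∀ c, triple (K := K) a b c ∈ J)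
    (h₄ : ∀ a ∈ I, ∀ b, ∀ c ∈ lowerSeq I n, triple (K := K) a b c ∈ J)
    (h₅ : ∀ a, ∀ b ∈ I, ∀ c ∈ lowerSeq I n, triple (K := K) a b c ∈ J)
    (h₆ : ∀ a, ∀ b ∈ lowerSeq I n, ∀ c ∈ I, triple (K := K) a b c ∈ J) :
    lowerSeq I (n + 1) ≤ J := by
  simp only [lowerSeq, sup_le_iff, tripleSpan_le]
  exact ⟨⟨⟨⟨⟨fun a ha b hb c _ ↦ h₁ a ha b hb c, fun a ha b _ c hc ↦ h₂ a ha b c hc⟩,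
    fun a ha b hb c _ ↦ h₃ a ha b hb c⟩, fun a ha b _ c hc ↦ h₄ a ha b c hc⟩,
    fun a _ b hb c hc ↦ h₅ a b hb c hc⟩, fun a _ b hb c hc ↦ h₆ a b hb c hc⟩

/-- The endomorphisms that shift the sequence of subspaces `V` by at least `n` steps. -/
def shiftingEnd {M : Type*} [AddCommGroup M] [Module K M] (V : ℕ → Submodule K M) (n : ℕ) :
    Submodule K (Module.End K M) where
  carrier := {φ | ∀ k, ∀ v ∈ V k, φ v ∈ V (k + n)}
  add_mem' hφ hψ k v hv := add_mem (hφ k v hv) (hψ k v hv)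
  zero_mem' _ _ _ := zero_mem _
  smul_mem' c _ hφ k v hv := Submodule.smul_mem _ c (hφ k v hv)

theorem lie_mem_shiftingEnd {M : Type*} [AddCommGroup M] [Module K M] {V : ℕ → Submodule K M}
    {m n : ℕ} {φ ψ : Module.End K M} (hφ : φ ∈ shiftingEnd V m) (hψ : ψ ∈ shiftingEnd V n) :
    ⁅φ, ψ⁆ ∈ shiftingEnd V (m + n) := by
  intro k v hv
  rw [Ring.lie_def]
  refine sub_mem ?_ ?_
  · have := hφ _ _ (hψ k v hv)
    rwa [add_assoc, add_comm n] at this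
  · have := hψ _ _ (hφ k v hv)
    rwa [add_assoc] at this

/-- An ideal is nilpotent as soon as right multiplications stabilise a finite filtration of the
standard Leibniz envelope and those by elements of the ideal shift it. -/
theorem IsIdeal.isNilpotentIdeal_of_filtration {I : Submodule K T} (hI : IsIdeal I)
    {V : ℕ → Submodule K (T × leftMulSpan K T)} (hV : Antitone V) (hV₀ : V 0 = ⊤) {N : ℕ} (hN : V N = ⊥)
    (hT : ∀ b, rightMul K T b ∈ shiftingEnd V 0)
    (hVI : ∀ b ∈ I, rightMul K T b ∈ shiftingEnd V 1) : IsNilpotentIdeal I := by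
  -- The shift is `n + 1` because `I` itself, the term of index `0`, already shifts by one.
  have hshift (n : ℕ) :
      lowerSeq I n ≤ (shiftingEnd V (n + 1)).comap (rightMul K T) := by
    induction n with
    | zero => exact hVI
    | succ n ih =>
      have key {i j k : ℕ} (h : i + j + k = n + 1 + 1) {a b c : T}
          (ha : rightMul K T a ∈ shiftingEnd V i) (hb : rightMul K T b ∈ shiftingEnd V j)
          (hc : rightMul K T c ∈ shiftingEnd V k) :
          triple (K := K) a b c ∈ (shiftingEnd V (n + 1 + 1)).comap (rightMul K T) := by
        rw [Submodule.mem_comap, rightMul_triple, ← h]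
        exact lie_mem_shiftingEnd (lie_mem_shiftingEnd ha hb) hc
      exact lowerSeq_succ_le
        (fun a ha b hb c ↦ key (by lia) (ih ha) (hVI b hb) (hT c))
        (fun a ha b c hc ↦ key (by lia) (ih ha) (hT b) (hVI c hc))
        (fun a ha b hb c ↦ key (by lia) (hVI a ha) (ih hb) (hT c))
        (fun a ha b c hc ↦ key (by lia) (hVI a ha) (hT b) (ih hc))
        (fun a b hb c hc ↦ key (by lia) (hT a) (hVI b hb) (ih hc))
        (fun a b hb c hc ↦ key (by lia) (hT a) (ih hb) (hVI c hc))
  have hzero {n : ℕ} (hn : N ≤ n) {x : T} (hx : x ∈ lowerSeq I n) (v : T × leftMulSpan K T) :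
      rightMul K T x v = 0 := by
    have h₀ := hshift n hx 0 v (hV₀ ▸ Submodule.mem_top)
    have h₁ := hV (show N ≤ 0 + (n + 1) by lia) h₀
    rwa [hN, Submodule.mem_bot] at h₁
  have hmid {n : ℕ} (hn : N ≤ n) {b : T} (hb : b ∈ lowerSeq I n) (a c : T) :
      triple (K := K) a b c = 0 :=
    LinearMap.congr_fun (congrArg (fun w ↦ (w.2 : T →ₗ[K] T)) (hzero hn hb (a, 0))) c
  have hright {n : ℕ} (hn : N ≤ n) {c : T} (hc : c ∈ lowerSeq I n) (a b : T) :
      triple (K := K) a b c = 0 :=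
    congrArg Prod.fst (hzero hn hc (0, ⟨_, triple_mem_leftMulSpan a b⟩))
  -- From index `N` on, only products with the lower term in the left slot survive. These are `R c
  -- (R b a)` with `b` or `c` in `I`, one step deeper in the filtration.
  have hleft (k : ℕ) : lowerSeq I (N + k) ≤ (V k).comap (LinearMap.inl K T (leftMulSpan K T)) := by
    induction k with
    | zero => exact fun x _ ↦ by rw [hV₀]; exact Submodule.mem_top
    | succ k ih =>
      have hN' : N ≤ N + k := Nat.le_add_right N k
      have hmul (a b c : T) : LinearMap.inl K T (leftMulSpan K T) (triple (K := K) a b c) =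
          rightMul K T c (rightMul K T b (LinearMap.inl K T (leftMulSpan K T) a)) :=
        Prod.ext rfl (Subtype.ext (by simp [rightMul_apply]))
      refine lowerSeq_succ_le (fun a ha b hb c ↦ ?_) (fun a ha b c hc ↦ ?_)
        (fun a _ b hb c ↦ hmid hN' hb a c ▸ zero_mem _)
        (fun a _ b c hc ↦ hright hN' hc a b ▸ zero_mem _)
        (fun a b _ c hc ↦ hright hN' hc a b ▸ zero_mem _)
        (fun a b hb c _ ↦ hmid hN' hb a c ▸ zero_mem _)
      all_goals rw [Submodule.mem_comap, hmul]
      · exact hT c _ _ (hVI b hb _ _ (ih ha))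
      · exact hVI c hc _ _ (hT b _ _ (ih ha))
  refine ⟨hI, N + N, le_bot_iff.mp fun x hx ↦ ?_⟩
  have hx' := hleft N hx
  rw [hN, Submodule.mem_comap, Submodule.mem_bot] at hx'
  exact congrArg Prod.fst hx'

end Nilpotent

-- Nilpotency of `{T T T}`

attribute [local instance 100] LieRing.ofAssociativeRing in
theorem IsSolvableSystem.isNilpotentIdeal_tripleSpan_top {K T : Type*} [Field K] [CharZero K]
    [AddCommGroup T] [Module K T] [FiniteDimensional K T] [LeibnizTripleSystem K T]
    (h : IsSolvableSystem K T) : IsNilpotentIdeal (tripleSpan (⊤ : Submodule K T) ⊤ ⊤) := by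
  let M := T × leftMulSpan K T
  let g := lieEnvelopeSubalgebra (L := Module.End K M) (rightMul K T) rightMul_triple
  have : LieAlgebra.IsSolvable g := isSolvable_lieEnvelopeSubalgebra h rightMul_triple
  let D := LieAlgebra.derivedSeries K g 1
  have hnil : LieModule.IsNilpotent D M := LieModule.isNilpotent_derivedSeries_of_isSolvable K g M
  obtain ⟨N, hN⟩ := (LieModule.isNilpotent_iff K D M).mp hnil
  have hmem (b : T) : rightMul K T b ∈ g := map_mem_lieEnvelope Submodule.mem_top
  have hD : tripleSpan ⊤ ⊤ ⊤ ≤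
      D.toSubmodule.comap ((rightMul K T).codRestrict g.toSubmodule hmem) := by
    refine tripleSpan_le.mpr fun a _ b _ c _ ↦ ?_
    have : (rightMul K T).codRestrict g.toSubmodule hmem (triple (K := K) a b c) =
      ⁅⁅(⟨_, hmem a⟩ : g), (⟨_, hmem b⟩ : g)⁆, (⟨_, hmem c⟩ : g)⁆ :=
      Subtype.ext (rightMul_triple a b c)
    rw [Submodule.mem_comap, this]
    exact LieSubmodule.lie_mem_lie (LieSubmodule.mem_top _) (LieSubmodule.mem_top _)
  -- Since `D` is an ideal of `g`, the terms of its lower central series on `M` are stable under all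
  -- of `g`, as required of right multiplications by arbitrary elements.
  refine isIdeal_tripleSpan_top.isNilpotentIdeal_of_filtration
    (V := fun k ↦ (D.lcs M k).toSubmodule)
    (antitone_nat_of_succ_le fun k ↦ ?_) rfl (N := N) ?_ (fun b k v hv ↦ ?_) fun b hb k v hv ↦ ?_
  · rw [LieIdeal.lcs_succ]
    exact LieSubmodule.lie_le_right _ _
  · rw [LieIdeal.coe_lcs_eq, hN]; rfl
  · exact (D.lcs M k).lie_mem (x := (⟨_, hmem b⟩ : g)) hv
  · change _ ∈ D.lcs M (k + 1)
    rw [LieIdeal.lcs_succ]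
    exact LieSubmodule.lie_mem_lie (x := (⟨_, hmem b⟩ : g)) (hD hb) hv

end LeibnizTripleSystem

theorem mainTheorem9 {K T : Type*} [Field K] [CharZero K] [AddCommGroup T] [Module K T]
    [FiniteDimensional K T] [LeibnizTripleSystem K T] :
    (LeibnizTripleSystem.IsNilpotentSystem K T → LeibnizTripleSystem.IsSolvableSystem K T) ∧
    (LeibnizTripleSystem.IsSolvableSystem K T →
      LeibnizTripleSystem.lowerSeq (⊤ : Submodule K T) 1 =
          LeibnizTripleSystem.tripleSpan (⊤ : Submodule K T) ⊤ ⊤ ∧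
        LeibnizTripleSystem.IsNilpotentIdeal
          (LeibnizTripleSystem.tripleSpan (⊤ : Submodule K T) ⊤ ⊤)) :=
  ⟨LeibnizTripleSystem.IsNilpotentSystem.isSolvableSystem, fun h ↦
    ⟨LeibnizTripleSystem.lowerSeq_top_one, h.isNilpotentIdeal_tripleSpan_top⟩⟩
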